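/- Let $N\ge 2$, $m\ge 1$, and assume the following. - $\Omega\subseteq\mathbb R^N$ is a bounded domain, convex in the $x_1$-direction and symmetric with respect to $\Pi_0=\{x_1=0\}$. - $\Gamma\subseteq\Omega\cap\Pi_0$ is compact with $\mathrm{Cap}_p(\Gamma)=0$, $p:=\max_k p_k$. That is, for every open $\mathcal O\supseteq\Gamma$ the infimum of $\int_{\mathbb R^N}|\nabla\phi|^{p}\,dx$ over all $\phi\in C_c^\infty(\mathcal O)$ with $\phi\ge1$ on $\Gamma$ is $0$. - For every $i=1,\dots,m$, either $\frac{2N+2}{N+2}<p_i\le N$ and $\max\{p_i-1,1\}\le q_i<p_i$, or $2\le p_i\le N$ and $q_i=p_i$. - Each $a_i:[0,\infty)\to\mathbb R$ is Lipschitz continuous on $[0,M]$ for every $M>0$. - Each $f_i:[0,\infty)^m\to\mathbb R$ is of class $C^1$, with $f_i(t)>0$ whenever $t_1,\dots,t_m>0$, and $\partial_{t_k}f_i\ge0$ on $[0,\infty)^m$ for $k\ne i$. Let $\alpha\in(0,1]$ and let $\mathbf u=(u_1,\dots,u_m)\in C^{1,\alpha}(\overline\Omega\setminus\Gamma;\mathbb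 R^m)$ (the functions and their gradients are continuous up to $\partial\Omega$ away from $\Gamma$, the gradients being $\alpha$-Hölder continuous on compact subsets of $\overline\Omega\setminus\Gamma$) satisfy, for every $i$: $u_i>0$ in $\Omega\setminus\Gamma$, $u_i=0$ on $\partial\Omega$, and $$\int_\Omega|\nabla u_i|^{p_i-2}\langle\nabla u_i,\nabla\varphi\rangle\,dx+\int_\Omega a_i(u_i)|\nabla u_i|^{q_i}\varphi\,dx=\int_\Omega f_i(u_1,\dots,u_m)\varphi\,dx\qquad\text{for all }\varphi\in C_c^1(\Omega\setminus\Gamma).$$ Put $\varrho:=\inf_{x\in\Omega}x_1$ and, for $\lambda\in(\varrho,0)$, $R_\lambda(x):=(2\lambda-x_1,x_2,\dots,x_N)$, $\Omega_\lambda:=\{x\in\Omega: x_1<\lambda\}$, $u_{i,\lambda}:=u_i\circ R_\lambda$. Let $i\in\{1,\dots,m\}$ and $\lambda\in(\varrho,0)$ be such that $R_\lambda(\Gamma)\cap\overline{\Omega_\lambda}\ne\varnothing$. Then there is a constant $\mathbf c_i>0$ such that $$\int_{\Omega_\lambda}\bigl(|\nabla u_i|+|\nabla u_{i,\lambda}|\bigr)^{p_i-2}\,\bigl|\nabla(u_i-u_{i,\lambda})^+\bigr|^2\,dx\le\mathbf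 c_i .$$ In particular, the integral is finite. (The integrand is defined almost everywhere, and is understood to be $0$ where $\nabla u_i=\nabla u_{i,\lambda}=0$.) -/

import Mathlib

open MeasureTheory
open scoped NNReal ENNReal

noncomputable section

namespace SingularPLaplace

/-- The Euclidean space of dimension `N`; its first coordinate `x₁` is `x 0`. -/
abbrev Space (N : ℕ) : Type := EuclideanSpace ℝ (Fin N)

/-- The reflection `(x₁, x₂, …) ↦ (2 * lam - x₁, x₂, …)` through the hyperplane `x₁ = lam`. -/
def reflect {N : ℕ} [NeZero N] (lam : ℝ) (x : Space N) : Space N :=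
  WithLp.toLp 2 (fun j => if j = 0 then 2 * lam - x 0 else x j)

/-- The capacity of the condenser `(K, O)`: the infimum of the integrals of `|∇φ| ^ r` over
all smooth `φ`, compactly supported in `O`, with `φ ≥ 1` on `K`. -/
def condenserCapacity {N : ℕ} (r : ℝ) (K O : Set (Space N)) : ℝ≥0∞ :=
  sInf {e : ℝ≥0∞ | ∃ φ : Space N → ℝ,
    ContDiff ℝ ((⊤ : ℕ∞) : WithTop ℕ∞) φ ∧ HasCompactSupport φ ∧ tsupport φ ⊆ O ∧
    (∀ x ∈ K, 1 ≤ φ x) ∧ e = ∫⁻ x, ‖gradient φ x‖ₑ ^ r}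

/-- `K` has vanishing `r`-capacity. -/
def ZeroCapacity {N : ℕ} (r : ℝ) (K : Set (Space N)) : Prop :=
  ∀ O : Set (Space N), IsOpen O → K ⊆ O → condenserCapacity r K O = 0

/-- `Ω` is a bounded domain, convex in the `x₁`-direction and symmetric with respect to the
hyperplane `x₁ = 0`. -/
structure DomainAssumption {N : ℕ} [NeZero N] (Ω : Set (Space N)) : Prop where
  isOpen : IsOpen Ω
  isConnected : IsConnected Ω
  isBounded : Bornology.IsBounded Ω
  convex_x1 : ∀ x ∈ Ω, ∀ y ∈ Ω, (∀ j, j ≠ 0 → x j = y j) → segment ℝ x y ⊆ Ω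
  symmetric : ∀ x ∈ Ω, reflect 0 x ∈ Ω

/-- `Γ` is a compact subset of `Ω ∩ {x₁ = 0}` of vanishing `r`-capacity. -/
structure SingularSetAssumption {N : ℕ} [NeZero N] (Ω Γ : Set (Space N)) (r : ℝ) : Prop where
  isCompact : IsCompact Γ
  subset : Γ ⊆ Ω ∩ {x | x 0 = 0}
  zeroCapacity : ZeroCapacity r Γ

/-- The admissible pairs of exponents in dimension `N`. -/
def ExponentAssumption (N : ℕ) (p q : ℝ) : Prop :=
  ((2 * (N : ℝ) + 2) / ((N : ℝ) + 2) < p ∧ p ≤ N ∧ max (p - 1) 1 ≤ q ∧ q < p) ∨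
  (2 ≤ p ∧ p ≤ N ∧ q = p)

/-- `a` is locally Lipschitz continuous on `[0, ∞)`. -/
def CoefficientAssumption (a : ℝ → ℝ) : Prop :=
  ∀ M : ℝ, 0 < M → ∃ L : ℝ, 0 < L ∧
    ∀ t ∈ Set.Icc 0 M, ∀ s ∈ Set.Icc 0 M, |a t - a s| ≤ L * |t - s|

/-- The functions `f i` are of class `C¹` on the closed orthant `[0, ∞)ᵐ` (written
`Set.Ici 0`), positive when all the arguments are positive, and cooperative. -/
structure SourceAssumption {m : ℕ} (f : Fin m → (Fin m → ℝ) → ℝ) : Prop where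
  contDiffOn : ∀ i, ContDiffOn ℝ 1 (f i) (Set.Ici 0)
  pos : ∀ i, ∀ t : Fin m → ℝ, (∀ k, 0 < t k) → 0 < f i t
  cooperative : ∀ i k, i ≠ k → ∀ t ∈ Set.Ici (0 : Fin m → ℝ),
    0 ≤ fderivWithin ℝ (f i) (Set.Ici 0) t (Pi.single k 1)

/-- `v` is of class `C^{1,α}` on `closure Ω \ Γ`: it is continuous there, it is differentiable
on `Ω \ Γ`, and its gradient extends to `closure Ω \ Γ` as a continuous field `G` that is
`α`-Hölder continuous on every compact subset of `closure Ω \ Γ`. No control near `Γ` is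
required. -/
def IsC1Holder {N : ℕ} (α : ℝ≥0) (Ω Γ : Set (Space N)) (v : Space N → ℝ) : Prop :=
  ContinuousOn v (closure Ω \ Γ) ∧
  ∃ G : Space N → Space N, ContinuousOn G (closure Ω \ Γ) ∧
    (∀ x ∈ Ω \ Γ, HasGradientAt v (G x) x) ∧
    ∀ K : Set (Space N), IsCompact K → K ⊆ closure Ω \ Γ → ∃ C : ℝ≥0, HolderOnWith C α G K

/-- `u` is a weak solution, of class `C^{1,α}` on `closure Ω \ Γ`, of the system
`-Δ_{pᵢ} uᵢ + aᵢ(uᵢ) |∇uᵢ| ^ qᵢ = fᵢ(u)` and `uᵢ > 0` in `Ω \ Γ`, `uᵢ = 0` on `∂Ω`.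
The values of `u` outside `closure Ω \ Γ` are irrelevant. -/
structure IsWeakSolution {N m : ℕ} (α : ℝ≥0) (Ω Γ : Set (Space N)) (p q : Fin m → ℝ)
    (a : Fin m → ℝ → ℝ) (f : Fin m → (Fin m → ℝ) → ℝ) (u : Fin m → Space N → ℝ) : Prop where
  regular : ∀ i, IsC1Holder α Ω Γ (u i)
  equation : ∀ i, ∀ φ : Space N → ℝ, ContDiff ℝ 1 φ → HasCompactSupport φ →
    tsupport φ ⊆ Ω \ Γ →
    (∫ x in Ω, ‖gradient (u i) x‖ ^ (p i - 2) * inner ℝ (gradient (u i) x) (gradient φ x))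
      + (∫ x in Ω, a i (u i x) * ‖gradient (u i) x‖ ^ (q i) * φ x)
      = ∫ x in Ω, f i (fun k => u k x) * φ x
  pos : ∀ i, ∀ x ∈ Ω \ Γ, 0 < u i x
  boundary : ∀ i, ∀ x ∈ frontier Ω, u i x = 0

/-- `ϱ`, the infimum of `x₁` over `Ω`. -/
def leftEnd {N : ℕ} [NeZero N] (Ω : Set (Space N)) : ℝ :=
  sInf ((fun x : Space N => x 0) '' Ω)

/-- The cap `Ω_λ`, the part of `Ω` where `x₁ < λ`. -/
def leftCap {N : ℕ} [NeZero N] (Ω : Set (Space N)) (lam : ℝ) : Set (Space N) :=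
  {x ∈ Ω | x 0 < lam}

/-- The reflected function `v_λ = v ∘ R_λ`. -/
def reflected {N : ℕ} [NeZero N] (v : Space N → ℝ) (lam : ℝ) : Space N → ℝ :=
  fun x => v (reflect lam x)

/-- The positive part `(v - v_λ)⁺`. -/
def posDiff {N : ℕ} [NeZero N] (v : Space N → ℝ) (lam : ℝ) : Space N → ℝ :=
  fun x => max (v x - reflected v lam x) 0

/-- The density `(|∇v| + |∇v_λ|) ^ (p - 2) * |∇(v - v_λ)⁺| ^ 2`. For the functions `v` of
interest `(v - v_λ)⁺` is locally Lipschitz on `Ω_λ \ R_λ(Γ)`, hence differentiable at almost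
every point of `Ω_λ`, so that the pointwise gradient is its weak gradient. Where
`∇v = ∇v_λ = 0`, the density is `0` for every `p`. -/
def energyDensity {N : ℕ} [NeZero N] (p : ℝ) (v : Space N → ℝ) (lam : ℝ) (x : Space N) : ℝ :=
  (‖gradient v x‖ + ‖gradient (reflected v lam) x‖) ^ (p - 2)
    * ‖gradient (posDiff v lam) x‖ ^ 2

end SingularPLaplace

end

noncomputable section

namespace SingularPLaplace

open Set Filter Topology

/-! Only one of the two gradients can blow up on the cap. Its closure lies in `x₁ ≤ λ < 0`, away
from `Γ`, so `uᵢ` and `∇uᵢ` are bounded there, and the density is at most `(|∇uᵢ| + |∇uᵢ,λ|) ^ p`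
for every `p > 1`, supported where `uᵢ,λ < uᵢ`. It suffices that `|∇uᵢ,λ| ^ p` be integrable on that
set.

Reflecting exchanges the roles. On `D = R_λ(Ω_λ) ⊆ Ω` the function `w = uᵢ,λ` is regular, `u = uᵢ`
may be singular on `Γ`, and `∫ |∇u| ^ p` over `{u < w}` has to be finite. There `u < w ≤ M`, while
`w ≤ u` on `∂D \ Γ`. As `fᵢ(u) > 0` in `Ω \ Γ`, `u` is a supersolution, and it can be tested with
`exp(-Λu) T(w - u) ψ ^ (k + 1)`. The exponential absorbs the term `a(u)|∇u| ^ q`, since `|a| ≤ Λ` on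
`[0, M]` and `q ≤ p`; the factor `T(w - u)` produces the good term `-|∇u| ^ p`; the cutoff `ψ`
vanishes near `Γ`, and Young's inequality absorbs its gradient (`flux_testFunction_le`).

Zero capacity supplies cutoffs supported off `Γ`, equal to one outside arbitrarily small
neighbourhoods, with uniformly bounded energy (`exists_cutoff`). Boundedness is enough: the estimate
of `exists_truncated_energy_bound` is uniform in the truncation, and monotone convergence removes
the truncation in `lintegral_gradient_rpow_lt_top`. -/

/-- The linear part of the reflections `reflect lam`. -/
def reflectLinear (N : ℕ) [NeZero N] : Space N ≃ₗᵢ[ℝ] Space N :=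
  LinearIsometryEquiv.piLpCongrRight 2
    (fun j : Fin N => if j = 0 then LinearIsometryEquiv.neg ℝ else LinearIsometryEquiv.refl ℝ ℝ)

/-! ### Reflections through the hyperplanes `x₁ = λ` -/

section Reflection

variable {N : ℕ} [NeZero N]

lemma reflect_apply_zero (lam : ℝ) (x : Space N) : reflect lam x 0 = 2 * lam - x 0 := by
  simp [reflect]

lemma reflect_apply_ne (lam : ℝ) (x : Space N) {j : Fin N} (hj : j ≠ 0) :
    reflect lam x j = x j := by
  simp [reflect, hj]

lemma reflect_eq_linear_add (lam : ℝ) (x : Space N) :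
    reflect lam x = reflectLinear N x + EuclideanSpace.single 0 (2 * lam) := by
  ext j
  by_cases hj : j = 0
  · subst hj
    simp [reflect, reflectLinear]
    ring
  · simp [reflect, reflectLinear, hj]

lemma reflect_reflect (lam : ℝ) (x : Space N) : reflect lam (reflect lam x) = x := by
  ext j
  by_cases hj : j = 0
  · subst hj; simp [reflect]
  · simp [reflect, hj]

lemma reflect_eq_self {lam : ℝ} {x : Space N} (hx : x 0 = lam) : reflect lam x = x := by
  ext j
  by_cases hj : j = 0
  · subst hj; simp [reflect, hx]; ring
  · simp [reflect, hj]

lemma continuous_reflect (lam : ℝ) : Continuous (reflect lam : Space N → Space N) := by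
  have : (reflect lam : Space N → Space N) =
      fun x => reflectLinear N x + EuclideanSpace.single 0 (2 * lam) :=
    funext (reflect_eq_linear_add lam)
  rw [this]
  fun_prop

/-- The reflection `reflect lam` as a homeomorphism. -/
def reflectHomeomorph (lam : ℝ) : Space N ≃ₜ Space N where
  toFun := reflect lam
  invFun := reflect lam
  left_inv := reflect_reflect lam
  right_inv := reflect_reflect lam
  continuous_toFun := continuous_reflect lam
  continuous_invFun := continuous_reflect lam

lemma measurePreserving_reflect (lam : ℝ) :
    MeasurePreserving (reflect lam : Space N → Space N) volume volume := by
  have : (reflect lam : Space N → Space N) =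
      (fun x => x + EuclideanSpace.single 0 (2 * lam)) ∘ reflectLinear N :=
    funext (reflect_eq_linear_add lam)
  rw [this]
  exact (measurePreserving_add_right volume _).comp (reflectLinear N).measurePreserving

lemma measurableEmbedding_reflect (lam : ℝ) :
    MeasurableEmbedding (reflect lam : Space N → Space N) :=
  (reflectHomeomorph lam).measurableEmbedding

lemma contDiff_reflect (lam : ℝ) : ContDiff ℝ 1 (reflect lam : Space N → Space N) := by
  have : (reflect lam : Space N → Space N) =
      fun x => reflectLinear N x + EuclideanSpace.single 0 (2 * lam) :=
    funext (reflect_eq_linear_add lam)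
  rw [this]
  exact (reflectLinear N).contDiff.add contDiff_const

lemma hasFDerivAt_reflect (lam : ℝ) (x : Space N) :
    HasFDerivAt (reflect lam) (reflectLinear N : Space N →L[ℝ] Space N) x := by
  have : (reflect lam : Space N → Space N) =
      fun x => reflectLinear N x + EuclideanSpace.single 0 (2 * lam) :=
    funext (reflect_eq_linear_add lam)
  rw [this]
  exact (reflectLinear N : Space N ≃L[ℝ] Space N).hasFDerivAt.add_const _

lemma hasGradientAt_reflected {v : Space N → ℝ} {lam : ℝ} {g x : Space N}
    (h : HasGradientAt v g (reflect lam x)) :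
    HasGradientAt (reflected v lam) ((reflectLinear N).symm g) x := by
  rw [hasGradientAt_iff_hasFDerivAt] at h ⊢
  have := h.comp x (hasFDerivAt_reflect lam x)
  refine this.congr_fderiv ?_
  ext y
  simp [LinearIsometryEquiv.inner_map_eq_flip]

end Reflection

/-! ### Real inequalities, truncations and transition functions -/

section Elementary

lemma rpow_sub_two_mul_self {X p : ℝ} (hX : 0 ≤ X) (hp : 1 < p) :
    X ^ (p - 2) * X = X ^ (p - 1) := by
  rcases hX.eq_or_lt with h0 | h0
  · rw [← h0, Real.zero_rpow (by linarith : p - 1 ≠ 0), mul_zero]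
  · rw [← Real.rpow_add_one h0.ne']; congr 1; ring

lemma rpow_sub_two_mul_sq {X p : ℝ} (hX : 0 ≤ X) (hp : 1 < p) : X ^ (p - 2) * X ^ 2 = X ^ p := by
  calc X ^ (p - 2) * X ^ 2 = X ^ (p - 1) * X := by rw [← rpow_sub_two_mul_self hX hp]; ring
    _ = X ^ p := by
      rcases hX.eq_or_lt with h | h
      · rw [← h, Real.zero_rpow (by linarith : p ≠ 0), mul_zero]
      · rw [← Real.rpow_add_one h.ne']; congr 1; ring

/-- Enlarging `Z` to `X` avoids any case distinction on the sign of `p - 2`; this covers the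
singular range `p < 2`. -/
lemma rpow_sub_two_mul_sq_le {X Z p : ℝ} (hX : 0 ≤ X) (hZ : 0 ≤ Z) (hZX : Z ≤ X) (hp : 1 < p) :
    X ^ (p - 2) * Z ^ 2 ≤ X ^ p := by
  rw [← rpow_sub_two_mul_sq hX hp]
  gcongr

/-- Young's inequality in the form used to absorb the lower order terms. -/
lemma mul_rpow_sub_one_le {p X Z s : ℝ} {k : ℕ} (hp : 1 < p) (hk : p ≤ k + 1) (hX : 0 ≤ X)
    (hZ : 0 ≤ Z) (hs0 : 0 ≤ s) (hs1 : s ≤ 1) :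
    s ^ k * X ^ (p - 1) * Z ≤ 1 / 4 * (s ^ (k + 1) * X ^ p) + (4 * Z) ^ p := by
  have hp1 : 0 < p - 1 := by linarith
  have key : ∀ t : ℝ, 0 ≤ t → t ^ (p - 1) * t = t ^ p := fun t ht => by
    rcases ht.eq_or_lt with h | h
    · rw [← h, Real.zero_rpow (by linarith : p ≠ 0)]; simp
    · rw [Real.rpow_sub_one h.ne']; field_simp
  -- Either `Z` is at most a quarter of `s * X`, and the first term dominates, or `s * X < 4 * Z`,
  -- and `s ^ k ≤ s ^ (p - 1)` turns everything into a power of `4 * Z`.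
  by_cases h : 4 * Z ≤ s * X
  · have h1 : s ^ k * X ^ (p - 1) * Z ≤ s ^ k * X ^ (p - 1) * (s * X / 4) := by
      gcongr; linarith
    have h2 : s ^ k * X ^ (p - 1) * (s * X / 4) = 1 / 4 * (s ^ (k + 1) * X ^ p) := by
      rw [← key X hX]; ring
    have : 0 ≤ (4 * Z) ^ p := by positivity
    linarith
  · push Not at h
    have h1 : s ^ k ≤ s ^ (p - 1) := by
      rw [← Real.rpow_natCast]
      exact Real.rpow_le_rpow_of_exponent_ge_of_imp hs0 hs1 (by linarith)
        (fun _ h0 => by linarith)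
    have h2 : s ^ k * X ^ (p - 1) ≤ (4 * Z) ^ (p - 1) := by
      calc s ^ k * X ^ (p - 1) ≤ s ^ (p - 1) * X ^ (p - 1) := by gcongr
        _ = (s * X) ^ (p - 1) := (Real.mul_rpow hs0 hX).symm
        _ ≤ (4 * Z) ^ (p - 1) := by gcongr
    have h3 : s ^ k * X ^ (p - 1) * Z ≤ (4 * Z) ^ (p - 1) * (4 * Z) := by
      gcongr; linarith
    rw [key _ (by positivity)] at h3
    have : 0 ≤ s ^ (k + 1) * X ^ p := by positivity
    linarith

lemma rpow_le_one_add_rpow {t p q : ℝ} (ht : 0 ≤ t) (hp : 0 ≤ p) (hpq : p ≤ q) :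
    t ^ p ≤ 1 + t ^ q := by
  have : 0 ≤ t ^ q := by positivity
  rcases le_total t 1 with h | h
  · have := Real.rpow_le_one ht h hp
    linarith
  · have := Real.rpow_le_rpow_of_exponent_le h hpq
    linarith

lemma add_rpow_le {a b p : ℝ} (ha : 0 ≤ a) (hb : 0 ≤ b) (hp : 0 ≤ p) :
    (a + b) ^ p ≤ 2 ^ p * (a ^ p + b ^ p) := by
  have h2 : (0 : ℝ) ≤ 2 ^ p := by positivity
  rcases le_total a b with h | h
  · calc (a + b) ^ p ≤ (2 * b) ^ p := by gcongr; linarith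
      _ = 2 ^ p * b ^ p := Real.mul_rpow (by norm_num) hb
      _ ≤ _ := by gcongr; have := Real.rpow_nonneg ha p; linarith
  · calc (a + b) ^ p ≤ (2 * a) ^ p := by gcongr; linarith
      _ = 2 ^ p * a ^ p := Real.mul_rpow (by norm_num) ha
      _ ≤ _ := by gcongr; have := Real.rpow_nonneg hb p; linarith

/-- A `C¹` convex truncation vanishing below a positive level and of slope one above `δ`. -/
lemma exists_truncation {δ : ℝ} (hδ : 0 < δ) : ∃ T τ : ℝ → ℝ, ContDiff ℝ 1 T ∧
    (∀ s, HasDerivAt T (τ s) s) ∧ (∀ s, 0 ≤ τ s) ∧ (∀ s, τ s ≤ 1) ∧ (∀ s, δ ≤ s → τ s = 1) ∧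
    (∀ s, s ≤ δ / 2 → T s = 0) ∧ (∀ s, 0 ≤ T s) ∧ (∀ s, 0 ≤ s → T s ≤ s * τ s) := by
  -- The slope rises linearly from `0` at `δ / 2` to `1` at `δ`; `T` is its primitive.
  let τ : ℝ → ℝ := fun s => max 0 (min 1 (2 * s / δ - 1))
  have hτc : Continuous τ := by fun_prop
  have hmono : Monotone τ := fun a b h => by dsimp only [τ]; gcongr
  have h0 : ∀ s, 0 ≤ τ s := fun s => le_max_left _ _
  have hz : ∀ s, s ≤ δ / 2 → τ s = 0 := fun s hs => by
    have : 2 * s / δ ≤ 1 := by rw [div_le_one hδ]; linarith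
    exact max_eq_left (le_trans (min_le_right _ _) (by linarith))
  have hd : ∀ s, HasDerivAt (fun u => ∫ x in (0 : ℝ)..u, τ x) (τ s) s := fun s =>
    (hτc.integral_hasStrictDerivAt 0 s).hasDerivAt
  have hT0 : ∀ s, s ≤ δ / 2 → ∫ x in (0 : ℝ)..s, τ x = 0 := fun s hs => by
    rw [intervalIntegral.integral_congr (g := fun _ => (0 : ℝ))]
    · simp
    · intro x hx
      refine hz x ?_
      rcases le_total 0 s with h | h
      · rw [uIcc_of_le h] at hx; exact hx.2.trans hs
      · rw [uIcc_of_ge h] at hx; linarith [hx.2]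
  refine ⟨fun u => ∫ x in (0 : ℝ)..u, τ x, τ, ?_, hd, h0, ?_, ?_, hT0, ?_, ?_⟩
  · rw [contDiff_one_iff_deriv]
    refine ⟨fun s => (hd s).differentiableAt, ?_⟩
    rwa [show deriv (fun u => ∫ x in (0 : ℝ)..u, τ x) = τ from funext fun s => (hd s).deriv]
  · exact fun s => max_le zero_le_one (min_le_left _ _)
  · intro s hs
    have : 2 ≤ 2 * s / δ := by rw [le_div_iff₀ hδ]; linarith
    dsimp only [τ]
    rw [min_eq_left (by linarith), max_eq_right zero_le_one]
  · intro s
    rcases le_total 0 s with h | h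
    · exact intervalIntegral.integral_nonneg h fun x _ => h0 x
    · exact (hT0 s (by linarith)).ge
  · intro s hs
    -- Convexity: the slope at the right endpoint is the largest on `[0, s]`.
    calc ∫ x in (0 : ℝ)..s, τ x ≤ ∫ _ in (0 : ℝ)..s, τ s :=
          intervalIntegral.integral_mono_on hs (hτc.intervalIntegrable _ _)
            (by simp) fun x hx => hmono hx.2
      _ = s * τ s := by simp

lemma exists_bound_deriv_smoothTransition :
    ∃ K : ℝ, 0 ≤ K ∧ ∀ t, |deriv Real.smoothTransition t| ≤ K := by
  have hcd : ContDiff ℝ 1 Real.smoothTransition := Real.smoothTransition.contDiff (n := 1)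
  have hc : Continuous (deriv Real.smoothTransition) := hcd.continuous_deriv le_rfl
  obtain ⟨K, hK⟩ := (isCompact_Icc (a := (0 : ℝ)) (b := 1)).exists_bound_of_continuousOn
    hc.continuousOn
  refine ⟨K, (norm_nonneg _).trans (hK 0 (by simp)), fun t => ?_⟩
  have hK0 : 0 ≤ K := (norm_nonneg _).trans (hK 0 (by simp))
  by_cases ht : t ∈ Icc (0 : ℝ) 1
  · exact hK t ht
  · have : deriv Real.smoothTransition t = 0 := by
      rw [mem_Icc, not_and_or, not_le, not_le] at ht
      rcases ht with h | h
      · have : Real.smoothTransition =ᶠ[𝓝 t] fun _ => 0 := by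
          filter_upwards [Iio_mem_nhds h] with s hs
          exact Real.smoothTransition.zero_of_nonpos (le_of_lt hs)
        rw [this.deriv_eq]; simp
      · have : Real.smoothTransition =ᶠ[𝓝 t] fun _ => 1 := by
          filter_upwards [Ioi_mem_nhds h] with s hs
          exact Real.smoothTransition.one_of_one_le (le_of_lt hs)
        rw [this.deriv_eq]; simp
    rw [this]; simpa using hK0

end Elementary

/-! ### Gradients and capacity cutoffs -/

section Gradient

variable {N : ℕ}

lemma continuousOn_gradient {v : Space N → ℝ} {s : Set (Space N)} (hs : IsOpen s)
    (hv : ContDiffOn ℝ 1 v s) : ContinuousOn (gradient v) s :=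
  (InnerProductSpace.toDual ℝ (Space N)).symm.continuous.comp_continuousOn
    (hv.continuousOn_fderiv_of_isOpen hs le_rfl)

lemma contDiffOn_of_hasGradientAt {v : Space N → ℝ} {G : Space N → Space N}
    {s : Set (Space N)} (hs : IsOpen s) (hG : ContinuousOn G s)
    (h : ∀ x ∈ s, HasGradientAt v (G x) x) : ContDiffOn ℝ 1 v s := by
  rw [show (1 : WithTop ℕ∞) = 0 + 1 by simp, contDiffOn_succ_iff_fderiv_of_isOpen hs]
  refine ⟨fun x hx => (h x hx).differentiableAt.differentiableWithinAt, by simp, ?_⟩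
  rw [contDiffOn_zero]
  refine ((InnerProductSpace.toDual ℝ (Space N)).continuous.comp_continuousOn hG).congr ?_
  intro x hx
  exact (hasGradientAt_iff_hasFDerivAt.1 (h x hx)).fderiv

lemma gradient_eq_zero_of_notMem_tsupport {φ : Space N → ℝ} {x : Space N}
    (hx : x ∉ tsupport φ) : gradient φ x = 0 := by
  simp [gradient, fderiv_of_notMem_tsupport ℝ hx]

/-- Sets of vanishing capacity admit cutoff functions of bounded energy. -/
lemma exists_cutoff {r : ℝ} (hr : 0 < r) : ∃ C : ℝ≥0∞, C ≠ ⊤ ∧ ∀ Γ : Set (Space N),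
    ZeroCapacity r Γ → ∀ O : Set (Space N), IsOpen O → Γ ⊆ O →
    ∃ ψ : Space N → ℝ, ContDiff ℝ 1 ψ ∧ (∀ x, 0 ≤ ψ x) ∧ (∀ x, ψ x ≤ 1) ∧
      (∃ U : Set (Space N), IsOpen U ∧ Γ ⊆ U ∧ ∀ x ∈ U, ψ x = 0) ∧ (∀ x ∉ O, ψ x = 1) ∧
      ∫⁻ x, ‖gradient ψ x‖ₑ ^ r ≤ C := by
  obtain ⟨K, hK0, hK⟩ := exists_bound_deriv_smoothTransition
  have hst : ContDiff ℝ 1 Real.smoothTransition := Real.smoothTransition.contDiff (n := 1)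
  refine ⟨ENNReal.ofReal (2 * K) ^ r, by finiteness, fun Γ hΓ O hO hΓO => ?_⟩
  -- Any fixed positive threshold would do; only a bound independent of `O` matters.
  have hcap : condenserCapacity r Γ O < 1 := by rw [hΓ O hO hΓO]; exact zero_lt_one
  obtain ⟨e, ⟨φ, hφ, -, hφs, hφΓ, rfl⟩, he⟩ := sInf_lt_iff.1 hcap
  have hφ1 : ContDiff ℝ 1 φ := hφ.of_le (by exact_mod_cast le_top)
  have hgrad : ∀ x, gradient (fun x => 1 - Real.smoothTransition (2 * φ x)) x
      = -(2 * deriv Real.smoothTransition (2 * φ x)) • gradient φ x := fun x => by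
    have h1 := ((hφ1.differentiable one_ne_zero) x).hasGradientAt
    have h2 := ((hst.differentiable one_ne_zero) (2 * φ x)).hasDerivAt
    refine HasGradientAt.gradient ?_
    rw [hasGradientAt_iff_hasFDerivAt] at h1 ⊢
    refine ((h2.comp_hasFDerivAt x (h1.const_mul 2)).const_sub 1).congr_fderiv ?_
    ext y
    simp
    ring
  -- The factor `2` makes the cutoff vanish on all of `{φ > 1 / 2}`, an open neighbourhood of `Γ`,
  -- rather than on `Γ` alone.
  refine ⟨fun x => 1 - Real.smoothTransition (2 * φ x),
    contDiff_const.sub (hst.comp (contDiff_const.mul hφ1)),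
    fun x => sub_nonneg.2 (Real.smoothTransition.le_one _),
    fun x => sub_le_self _ (Real.smoothTransition.nonneg _),
    ⟨{x | 1 / 2 < φ x}, isOpen_lt continuous_const hφ.continuous, fun x hx => ?_,
      fun x hx => ?_⟩, fun x hx => ?_, ?_⟩
  · have := hφΓ x hx
    show 1 / 2 < φ x
    linarith
  · have hx' : 1 / 2 < φ x := hx
    dsimp only
    rw [Real.smoothTransition.one_of_one_le (by linarith), sub_self]
  · have : φ x = 0 := image_eq_zero_of_notMem_tsupport fun h => hx (hφs h)
    simp [this, Real.smoothTransition.zero]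
  · calc ∫⁻ x, ‖gradient (fun x => 1 - Real.smoothTransition (2 * φ x)) x‖ₑ ^ r
        ≤ ∫⁻ x, ENNReal.ofReal (2 * K) ^ r * ‖gradient φ x‖ₑ ^ r := by
          refine lintegral_mono fun x => ?_
          dsimp only
          rw [hgrad, enorm_smul, ← ENNReal.mul_rpow_of_nonneg _ _ hr.le]
          gcongr
          rw [Real.enorm_eq_ofReal_abs]
          refine ENNReal.ofReal_le_ofReal ?_
          rw [abs_neg, abs_mul, abs_two]
          gcongr
          exact hK _
      _ = ENNReal.ofReal (2 * K) ^ r * ∫⁻ x, ‖gradient φ x‖ₑ ^ r :=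
          lintegral_const_mul' _ _ (by finiteness)
      _ ≤ ENNReal.ofReal (2 * K) ^ r * 1 := by gcongr
      _ = _ := mul_one _

end Gradient

/-! ### Energy estimate for a singular supersolution below a regular function -/

section Caccioppoli

variable {N : ℕ}

/-- The test function comparing the supersolution `u` with the regular function `w`. -/
def testFunction (Λ : ℝ) (k : ℕ) (T : ℝ → ℝ) (u w ψ : Space N → ℝ) (x : Space N) : ℝ :=
  Real.exp (-Λ * u x) * (T (w x - u x) * ψ x ^ (k + 1))

lemma hasGradientAt_testFunction {Λ τ : ℝ} {k : ℕ} {T : ℝ → ℝ} {u w ψ : Space N → ℝ}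
    {x g g' h : Space N} (hu : HasGradientAt u g x) (hw : HasGradientAt w g' x)
    (hψ : HasGradientAt ψ h x) (hT : HasDerivAt T τ (w x - u x)) :
    HasGradientAt (testFunction Λ k T u w ψ)
      (Real.exp (-Λ * u x) • ((-(Λ * T (w x - u x) * ψ x ^ (k + 1))) • g
        + (τ * ψ x ^ (k + 1)) • (g' - g) + (T (w x - u x) * ((k + 1) * ψ x ^ k)) • h)) x := by
  rw [hasGradientAt_iff_hasFDerivAt] at hu hw hψ ⊢
  have h1 := (hu.const_mul (-Λ)).exp
  have h2 := hT.comp_hasFDerivAt x (hw.sub hu)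
  have h3 := hψ.pow (k + 1)
  refine (h1.mul (h2.mul h3)).congr_fderiv ?_
  ext y
  simp
  ring

/-- The pointwise inequality behind the energy estimate. -/
lemma flux_testFunction_le {Λ M B E T τ s a p q : ℝ} {k : ℕ} {g g' h : Space N}
    (hp : 1 < p) (hk : p ≤ k + 1) (hq0 : 0 ≤ q) (hqp : q ≤ p) (hΛ : 0 ≤ Λ) (ha : |a| ≤ Λ)
    (hE0 : 0 ≤ E) (hE1 : E ≤ 1) (hτ0 : 0 ≤ τ) (hτ1 : τ ≤ 1) (hs0 : 0 ≤ s) (hs1 : s ≤ 1)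
    (hT0 : 0 ≤ T) (hT : T ≤ M * τ) (hM : 0 ≤ M) (hB : ‖g'‖ ≤ B) :
    1 / 2 * (E * τ * s ^ (k + 1) * ‖g‖ ^ p) ≤
      -(‖g‖ ^ (p - 2) * inner ℝ g (E • ((-(Λ * T * s ^ (k + 1))) • g
          + (τ * s ^ (k + 1)) • (g' - g) + (T * ((k + 1) * s ^ k)) • h))
        + a * ‖g‖ ^ q * (E * (T * s ^ (k + 1))))
      + (Λ * M + (4 * B) ^ p + (4 * (M * (k + 1))) ^ p) * (1 + ‖h‖ ^ p) := by
  have hB0 : 0 ≤ B := (norm_nonneg _).trans hB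
  set X := ‖g‖ with hX
  have hX0 : 0 ≤ X := norm_nonneg _
  set W := X ^ (p - 2) with hW
  have hW0 : 0 ≤ W := by positivity
  have hP1 : W * X = X ^ (p - 1) := rpow_sub_two_mul_self hX0 hp
  have hP : W * X ^ 2 = X ^ p := rpow_sub_two_mul_sq hX0 hp
  have hI1 : inner ℝ g g' ≤ X * B :=
    (real_inner_le_norm g g').trans (by gcongr)
  have hI2 : inner ℝ g h ≤ X * ‖h‖ := real_inner_le_norm g h
  have hY0 : 0 ≤ ‖h‖ := norm_nonneg _
  set Y := ‖h‖ with hY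
  have hinner : inner ℝ g (E • ((-(Λ * T * s ^ (k + 1))) • g
          + (τ * s ^ (k + 1)) • (g' - g) + (T * ((k + 1) * s ^ k)) • h))
      = E * (-(Λ * T * s ^ (k + 1)) * X ^ 2 + τ * s ^ (k + 1) * (inner ℝ g g' - X ^ 2)
        + T * ((k + 1) * s ^ k) * inner ℝ g h) := by
    simp only [inner_smul_right, inner_add_right, inner_sub_right, real_inner_self_eq_norm_sq, hX]
  rw [hinner]
  -- The `X ^ p` part is cancelled exactly by the derivative of the exponential; the `1` leaves the
  -- constant `Λ * M`.
  have hXq : X ^ q ≤ 1 + X ^ p := rpow_le_one_add_rpow hX0 hq0 hqp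
  have hXq0 : 0 ≤ X ^ q := by positivity
  have hXp0 : 0 ≤ X ^ p := by positivity
  have ha' : a * X ^ q * (E * (T * s ^ (k + 1))) ≤ Λ * (1 + X ^ p) * (E * (T * s ^ (k + 1))) := by
    gcongr
    exact (le_abs_self a).trans ha
  have hy1 : s ^ (k + 1) * X ^ (p - 1) * B ≤ 1 / 4 * (s ^ (k + 1) * X ^ p) + (4 * B) ^ p := by
    refine le_trans ?_ (mul_rpow_sub_one_le hp hk hX0 hB0 hs0 hs1)
    gcongr ?_ * _ * _
    exact pow_le_pow_of_le_one hs0 hs1 (Nat.le_succ k)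
  have hy2 := mul_rpow_sub_one_le (Z := M * (k + 1) * Y) hp hk hX0 (by positivity) hs0 hs1
  have hZ : (4 * (M * (k + 1) * Y)) ^ p = (4 * (M * (k + 1))) ^ p * Y ^ p := by
    rw [← Real.mul_rpow (by positivity) hY0]; ring_nf
  rw [hZ] at hy2
  set c1 := (4 * B) ^ p
  set c2 := (4 * (M * (k + 1))) ^ p
  have hc1 : 0 ≤ c1 := by positivity
  have hc2 : 0 ≤ c2 := by positivity
  have hYp : 0 ≤ Y ^ p := by positivity
  have t1 : W * (E * (τ * s ^ (k + 1) * inner ℝ g g'))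
      ≤ E * τ * (1 / 4 * (s ^ (k + 1) * X ^ p) + c1) := by
    calc W * (E * (τ * s ^ (k + 1) * inner ℝ g g'))
        ≤ W * (E * (τ * s ^ (k + 1) * (X * B))) := by gcongr
      _ = E * τ * (s ^ (k + 1) * X ^ (p - 1) * B) := by rw [← hP1]; ring
      _ ≤ _ := by gcongr
  -- The cutoff term carries `T`, the good term `τ`; `T ≤ M * τ` makes them comparable. With `t1`,
  -- half of the good term is used up.
  have t2 : W * (E * (T * ((k + 1) * s ^ k) * inner ℝ g h))
      ≤ E * τ * (1 / 4 * (s ^ (k + 1) * X ^ p) + c2 * Y ^ p) := by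
    calc W * (E * (T * ((k + 1) * s ^ k) * inner ℝ g h))
        ≤ W * (E * (T * ((k + 1) * s ^ k) * (X * Y))) := by gcongr
      _ = E * T * ((k + 1) * s ^ k * X ^ (p - 1) * Y) := by rw [← hP1]; ring
      _ ≤ E * (M * τ) * ((k + 1) * s ^ k * X ^ (p - 1) * Y) := by gcongr
      _ = E * τ * (s ^ k * X ^ (p - 1) * (M * (k + 1) * Y)) := by ring
      _ ≤ _ := by gcongr
  have hEτ : E * τ ≤ 1 := mul_le_one₀ hE1 hτ0 hτ1
  have t3 : Λ * (E * (T * s ^ (k + 1))) ≤ Λ * M := by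
    have h1 : T ≤ M := hT.trans (mul_le_of_le_one_right hM hτ1)
    have h2 : s ^ (k + 1) ≤ 1 := pow_le_one₀ hs0 hs1
    have : E * (T * s ^ (k + 1)) ≤ 1 * (M * 1) := by gcongr
    rw [one_mul, mul_one] at this
    gcongr
  have t4 : E * τ * (c1 + c2 * Y ^ p) ≤ c1 + c2 * Y ^ p :=
    mul_le_of_le_one_left (by positivity) hEτ
  have hexp : W * (E * (-(Λ * T * s ^ (k + 1)) * X ^ 2 + τ * s ^ (k + 1) * (inner ℝ g g' - X ^ 2)
        + T * ((k + 1) * s ^ k) * inner ℝ g h))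
      = -(Λ * X ^ p * (E * (T * s ^ (k + 1)))) + W * (E * (τ * s ^ (k + 1) * inner ℝ g g'))
        - E * τ * (s ^ (k + 1) * X ^ p) + W * (E * (T * ((k + 1) * s ^ k) * inner ℝ g h)) := by
    rw [← hP]; ring
  rw [hexp]
  have hrest : 0 ≤ Λ * M * Y ^ p + c1 * Y ^ p + c2 := by positivity
  generalize s ^ (k + 1) = S at *
  linarith [hrest, t1, t2, t3, t4, ha']

/-- Localisation of the support of the test function. -/
lemma testFunction_indicator_spec {Λ δ : ℝ} {k : ℕ} {T : ℝ → ℝ} {u w ψ : Space N → ℝ}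
    {Ω D Γ U : Set (Space N)} (hΩ : Bornology.IsBounded Ω) (hΓ : IsCompact Γ) (hDΩ : D ⊆ Ω)
    (hD : IsOpen D)
    (hu : ContDiffOn ℝ 1 u (Ω \ Γ)) (huc : ContinuousOn u (closure Ω \ Γ))
    (hw : ContDiffOn ℝ 1 w D) (hwc : ContinuousOn w (closure D))
    (hbd : ∀ x ∈ closure D, x ∉ D → x ∉ Γ → w x ≤ u x)
    (hδ : 0 < δ) (hT : ContDiff ℝ 1 T) (hTδ : ∀ s, s ≤ δ → T s = 0)
    (hψ : ContDiff ℝ 1 ψ) (hU : IsOpen U) (hΓU : Γ ⊆ U) (hψU : ∀ x ∈ U, ψ x = 0) :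
    ContDiff ℝ 1 (D.indicator (testFunction Λ k T u w ψ)) ∧
    HasCompactSupport (D.indicator (testFunction Λ k T u w ψ)) ∧
    tsupport (D.indicator (testFunction Λ k T u w ψ)) ⊆ {x ∈ D \ Γ | u x < w x} := by
  set φ := D.indicator (testFunction Λ k T u w ψ) with hφ
  have hDcl : closure D ⊆ closure Ω := closure_mono hDΩ
  -- `K` is compact because `U` removes the singular set. On the rest of `∂D` one has `w ≤ u`, which
  -- is incompatible with `w - u ≥ δ > 0`, so `K` stays inside `D`.
  let K : Set (Space N) := (closure D \ U) ∩ (fun x => w x - u x) ⁻¹' Ici δ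
  have hCU : IsCompact (closure D \ U) :=
    (Metric.isCompact_of_isClosed_isBounded isClosed_closure
      (hΩ.subset hDΩ).closure).diff hU
  have hK : IsCompact K := by
    refine hCU.of_isClosed_subset ?_ inter_subset_left
    refine ContinuousOn.preimage_isClosed_of_isClosed ?_ hCU.isClosed isClosed_Ici
    exact (hwc.mono sdiff_subset).sub
      (huc.mono fun x hx => ⟨hDcl hx.1, fun h => hx.2 (hΓU h)⟩)
  have hKD : K ⊆ D \ Γ := by
    rintro x ⟨⟨hx, hxU⟩, hxδ⟩
    have hxΓ : x ∉ Γ := fun h => hxU (hΓU h)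
    refine ⟨?_, hxΓ⟩
    by_contra hxD
    have h1 := hbd x hx hxD hxΓ
    have h2 : δ ≤ w x - u x := hxδ
    linarith
  have hsupp : Function.support φ ⊆ K := by
    intro x hx
    have hxD : x ∈ D := by
      by_contra h
      exact hx (indicator_of_notMem h _)
    rw [Function.mem_support, hφ, indicator_of_mem hxD, testFunction] at hx
    refine ⟨⟨subset_closure hxD, fun hxU => hx ?_⟩, ?_⟩
    · simp [hψU x hxU]
    · show δ ≤ w x - u x
      by_contra h
      exact hx (by simp [hTδ _ (not_le.1 h).le])
  have htsupp : tsupport φ ⊆ K := closure_minimal hsupp hK.isClosed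
  refine ⟨?_, hK.of_isClosed_subset (isClosed_tsupport _) htsupp, fun x hx =>
    ⟨hKD (htsupp hx), ?_⟩⟩
  swap
  · have : δ ≤ w x - u x := (htsupp hx).2
    linarith
  rw [contDiff_iff_contDiffAt]
  intro x
  by_cases hx : x ∈ K
  · have hxD := hKD hx
    have hnhds : D ∈ 𝓝 x := hD.mem_nhds hxD.1
    have hu' : ContDiffAt ℝ 1 u x := hu.contDiffAt
      (mem_of_superset ((hD.sdiff hΓ.isClosed).mem_nhds hxD) (sdiff_subset_sdiff_left hDΩ))
    have hw' : ContDiffAt ℝ 1 w x := hw.contDiffAt hnhds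
    have : ContDiffAt ℝ 1 (testFunction Λ k T u w ψ) x := by
      unfold testFunction
      exact (contDiffAt_const.mul hu').exp.mul
        ((hT.contDiffAt.comp x (hw'.sub hu')).mul (hψ.contDiffAt.pow _))
    refine this.congr_of_eventuallyEq ?_
    filter_upwards [hnhds] with y hy
    exact indicator_of_mem hy _
  · have : φ =ᶠ[𝓝 x] fun _ => 0 := by
      filter_upwards [hK.isClosed.isOpen_compl.mem_nhds hx] with y hy
      by_contra h
      exact hy (hsupp h)
    exact contDiffAt_const.congr_of_eventuallyEq this

/-- For `p < 2` the factor `|∇u| ^ (p - 2)` is unbounded near critical points, so continuity is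
replaced by measurability and the bound `|∇u| ^ (p - 1) |∇φ|`. -/
lemma integrable_flux {p : ℝ} (hp : 1 < p) {u φ : Space N → ℝ} {s : Set (Space N)}
    (hs : IsOpen s) (hu : ContDiffOn ℝ 1 u s) (hφ : ContDiff ℝ 1 φ) (hφc : HasCompactSupport φ)
    (hφs : tsupport φ ⊆ s) :
    Integrable (fun x => ‖gradient u x‖ ^ (p - 2) * inner ℝ (gradient u x) (gradient φ x)) := by
  have hsupp : Function.support
      (fun x => ‖gradient u x‖ ^ (p - 2) * inner ℝ (gradient u x) (gradient φ x))
        ⊆ tsupport φ := by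
    intro x hx
    by_contra h
    exact hx (by simp [gradient_eq_zero_of_notMem_tsupport h])
  rw [← integrableOn_iff_integrable_of_support_subset hsupp]
  have hK : IsCompact (tsupport φ) := hφc
  have hg : ContinuousOn (gradient u) (tsupport φ) := (continuousOn_gradient hs hu).mono hφs
  have hh : ContinuousOn (gradient φ) (tsupport φ) :=
    (continuousOn_gradient isOpen_univ hφ.contDiffOn).mono (subset_univ _)
  obtain ⟨B, hB⟩ := hK.exists_bound_of_continuousOn hg
  obtain ⟨B', hB'⟩ := hK.exists_bound_of_continuousOn hh
  have hm := hK.measurableSet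
  refine IntegrableOn.of_bound hK.measure_lt_top ?_ (B ^ (p - 1) * B') ?_
  · have hg' : AEStronglyMeasurable (gradient u) (volume.restrict (tsupport φ)) :=
      hg.aestronglyMeasurable hm
    exact (hg'.norm.aemeasurable.pow_const _).aestronglyMeasurable.mul
      (hg'.inner (hh.aestronglyMeasurable hm))
  · rw [ae_restrict_iff' hm]
    refine Eventually.of_forall fun x hx => ?_
    have h1 : 0 ≤ ‖gradient u x‖ ^ (p - 2) := by positivity
    rw [norm_mul, Real.norm_of_nonneg h1]
    have h2 := hB x hx
    have h3 := hB' x hx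
    have hB0 : 0 ≤ B := (norm_nonneg _).trans h2
    calc ‖gradient u x‖ ^ (p - 2) * ‖inner ℝ (gradient u x) (gradient φ x)‖
        ≤ ‖gradient u x‖ ^ (p - 2) * (‖gradient u x‖ * ‖gradient φ x‖) := by
          gcongr; exact norm_inner_le_norm _ _
      _ = ‖gradient u x‖ ^ (p - 1) * ‖gradient φ x‖ := by
          rw [← mul_assoc, rpow_sub_two_mul_self (norm_nonneg _) hp]
      _ ≤ B ^ (p - 1) * B' := by
          gcongr

lemma integrable_gradientTerm {q : ℝ} (hq : 0 ≤ q) {a : ℝ → ℝ} (ha : ContinuousOn a (Ici 0))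
    {u φ : Space N → ℝ} {s : Set (Space N)}
    (hs : IsOpen s) (hu : ContDiffOn ℝ 1 u s) (hu0 : ∀ x ∈ s, 0 ≤ u x) (hφ : Continuous φ)
    (hφc : HasCompactSupport φ) (hφs : tsupport φ ⊆ s) :
    Integrable (fun x => a (u x) * ‖gradient u x‖ ^ q * φ x) := by
  have hsupp : Function.support (fun x => a (u x) * ‖gradient u x‖ ^ q * φ x) ⊆ tsupport φ :=
    fun x hx => subset_tsupport φ (right_ne_zero_of_mul hx)
  rw [← integrableOn_iff_integrable_of_support_subset hsupp]
  have hK : IsCompact (tsupport φ) := hφc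
  refine ContinuousOn.integrableOn_compact hK ?_
  refine ((ha.comp (hu.continuousOn.mono hφs) fun x hx => hu0 x (hφs hx)).mul
    (((continuousOn_gradient hs hu).mono hφs).norm.rpow_const fun x _ => Or.inr hq)).mul
      hφ.continuousOn

/-- Truncated energy estimate, uniform in the truncation, for a singular supersolution `u`
compared with a regular function `w`. -/
lemma exists_truncated_energy_bound {p q r Λ M B : ℝ} {a : ℝ → ℝ} {u w : Space N → ℝ}
    {Ω D Γ : Set (Space N)} (hΩ : IsOpen Ω) (hΩb : Bornology.IsBounded Ω) (hΓ : IsCompact Γ)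
    (hcap : ZeroCapacity r Γ) (hDΩ : D ⊆ Ω) (hD : IsOpen D)
    (hp : 1 < p) (hpr : p ≤ r) (hq0 : 0 ≤ q) (hqp : q ≤ p)
    (ha : ContinuousOn a (Ici 0)) (haΛ : ∀ t ∈ Icc 0 M, |a t| ≤ Λ) (hΛ : 0 ≤ Λ) (hM : 0 ≤ M) (hB : 0 ≤ B)
    (hu : ContDiffOn ℝ 1 u (Ω \ Γ)) (huc : ContinuousOn u (closure Ω \ Γ))
    (hu0 : ∀ x ∈ Ω \ Γ, 0 ≤ u x)
    (hw : ContDiffOn ℝ 1 w D) (hwc : ContinuousOn w (closure D))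
    (hwM : ∀ x ∈ D, w x ≤ M) (hwB : ∀ x ∈ D, ‖gradient w x‖ ≤ B)
    (hbd : ∀ x ∈ closure D, x ∉ D → x ∉ Γ → w x ≤ u x)
    (hsuper : ∀ φ : Space N → ℝ, ContDiff ℝ 1 φ → HasCompactSupport φ → tsupport φ ⊆ Ω \ Γ →
      (∀ x, 0 ≤ φ x) →
      0 ≤ (∫ x in Ω, ‖gradient u x‖ ^ (p - 2) * inner ℝ (gradient u x) (gradient φ x))
        + ∫ x in Ω, a (u x) * ‖gradient u x‖ ^ q * φ x) :
    ∃ C : ℝ≥0∞, C ≠ ⊤ ∧ ∀ δ : ℝ, 0 < δ →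
      ∫⁻ x in {x ∈ D \ Γ | δ < w x - u x} \ Metric.thickening δ Γ, ‖gradient u x‖ₑ ^ p ≤ C := by
  obtain ⟨k, hk'⟩ := exists_nat_ge p
  have hk : p ≤ k + 1 := by linarith
  obtain ⟨Cψ, hCψ, hcut⟩ := exists_cutoff (N := N) (r := r) (by linarith)
  set C₀ := Λ * M + (4 * B) ^ p + (4 * (M * (k + 1))) ^ p with hC₀
  -- On `{u < w}` one has `u ≤ M`, so `exp(-Λ u)` is at least `exp(-Λ M)`.
  set c := 1 / 2 * Real.exp (-Λ * M) with hc
  have hcpos : 0 < c := by positivity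
  have hvol : volume Ω ≠ ⊤ := hΩb.measure_lt_top.ne
  refine ⟨(ENNReal.ofReal c)⁻¹ * (ENNReal.ofReal C₀ * (2 * volume Ω + Cψ)), ?_, ?_⟩
  · refine ENNReal.mul_ne_top (ENNReal.inv_ne_top.2 (by simpa using hcpos)) ?_
    finiteness
  intro δ hδ
  obtain ⟨T, τ, hTc, hTτ, hτ0, hτ1, hτδ, hTδ, hT0, hTle⟩ := exists_truncation hδ
  obtain ⟨ψ, hψ, hψ0, hψ1, ⟨U, hU, hΓU, hψU⟩, hψO, hψr⟩ := hcut Γ hcap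
    (Metric.thickening δ Γ) Metric.isOpen_thickening (Metric.self_subset_thickening hδ Γ)
  set A := {x ∈ D \ Γ | δ < w x - u x} \ Metric.thickening δ Γ with hA
  have hDΓ : IsOpen (D \ Γ) := hD.sdiff hΓ.isClosed
  have hΩΓ : IsOpen (Ω \ Γ) := hΩ.sdiff hΓ.isClosed
  have hDΓΩ : D \ Γ ⊆ Ω \ Γ := sdiff_subset_sdiff_left hDΩ
  have hAm : MeasurableSet A := by
    refine MeasurableSet.diff (IsOpen.measurableSet ?_) Metric.isOpen_thickening.measurableSet
    exact ((hw.continuousOn.mono sdiff_subset).sub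
      (hu.continuousOn.mono hDΓΩ)).isOpen_inter_preimage hDΓ isOpen_Ioi
  obtain ⟨hφ, hφc, hφs⟩ := testFunction_indicator_spec (Λ := Λ) (k := k) hΩb hΓ hDΩ hD hu huc
    hw hwc hbd (half_pos hδ) hTc hTδ hψ hU hΓU hψU
  set φ := D.indicator (testFunction Λ k T u w ψ) with hφdef
  have hφs' : tsupport φ ⊆ Ω \ Γ := fun x hx => hDΓΩ (hφs hx).1
  have hφ0 : ∀ x, 0 ≤ φ x := indicator_nonneg fun x _ =>
    mul_nonneg (Real.exp_pos _).le (mul_nonneg (hT0 _) (pow_nonneg (hψ0 x) _))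
  have hF1 := integrable_flux hp hΩΓ hu hφ hφc hφs'
  have hF2 := integrable_gradientTerm hq0 ha hΩΓ hu hu0 hφ.continuous hφc hφs'
  have hsup := hsuper φ hφ hφc hφs' hφ0
  set F1 := fun x => ‖gradient u x‖ ^ (p - 2) * inner ℝ (gradient u x) (gradient φ x) with hF1def
  set F2 := fun x => a (u x) * ‖gradient u x‖ ^ q * φ x with hF2def
  have hYint : IntegrableOn (fun x => 1 + ‖gradient ψ x‖ ^ p) Ω := by
    refine IntegrableOn.mono_set ?_ (subset_closure (s := Ω))
    have hψg : Continuous (gradient ψ) :=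
      continuousOn_univ.1 (continuousOn_gradient isOpen_univ hψ.contDiffOn)
    refine (Continuous.continuousOn ?_).integrableOn_compact hΩb.isCompact_closure
    exact continuous_const.add (hψg.norm.rpow_const fun x => Or.inr (by linarith))
  have hC₀0 : 0 ≤ C₀ := by positivity
  -- `H` dominates the good term, and its integral is bounded because the supersolution inequality
  -- makes the integral of `-(F1 + F2)` nonpositive.
  set H := fun x => -(F1 x + F2 x) + C₀ * (1 + ‖gradient ψ x‖ ^ p) with hH
  have hHint : IntegrableOn H Ω :=
    ((hF1.integrableOn.add hF2.integrableOn).neg).add (hYint.const_mul C₀)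
  have hmain : ∀ x ∈ D \ Γ, u x < w x →
      1 / 2 * (Real.exp (-Λ * u x) * τ (w x - u x) * ψ x ^ (k + 1) * ‖gradient u x‖ ^ p)
        ≤ H x := by
    intro x hx hux
    have hux0 := hu0 x (hDΓΩ hx)
    have hgu : HasGradientAt u (gradient u x) x :=
      ((hu.contDiffAt (hΩΓ.mem_nhds (hDΓΩ hx))).differentiableAt one_ne_zero).hasGradientAt
    have hgw : HasGradientAt w (gradient w x) x :=
      ((hw.contDiffAt (hD.mem_nhds hx.1)).differentiableAt one_ne_zero).hasGradientAt
    have hgψ : HasGradientAt ψ (gradient ψ x) x :=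
      (hψ.differentiable one_ne_zero x).hasGradientAt
    have hgφ := hasGradientAt_testFunction (Λ := Λ) (k := k) hgu hgw hgψ (hTτ (w x - u x))
    have hφx : φ x = testFunction Λ k T u w ψ x := indicator_of_mem hx.1 _
    have hφe : φ =ᶠ[𝓝 x] testFunction Λ k T u w ψ := by
      filter_upwards [hD.mem_nhds hx.1] with y hy
      exact indicator_of_mem hy _
    have hgφ' : gradient φ x = gradient (testFunction Λ k T u w ψ) x := by
      rw [gradient, hφe.fderiv_eq, gradient]
    have hM' : w x - u x ≤ M := by linarith [hwM x hx.1]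
    have := flux_testFunction_le (a := a (u x)) (g := gradient u x) (h := gradient ψ x)
      (T := T (w x - u x)) (τ := τ (w x - u x)) (s := ψ x) (E := Real.exp (-Λ * u x)) hp hk hq0 hqp
      hΛ (haΛ _ ⟨hux0, by linarith [hwM x hx.1]⟩) (Real.exp_pos _).le
      (Real.exp_le_one_iff.2 (by nlinarith)) (hτ0 _) (hτ1 _) (hψ0 x) (hψ1 x) (hT0 _)
      ((hTle _ (by linarith)).trans (by gcongr; exact hτ0 _)) hM (hwB x hx.1)
    simp only [hH, hF1def, hF2def]
    rw [hgφ', hgφ.gradient, hφx, testFunction]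
    exact this
  -- Nonnegativity everywhere allows enlarging the domain of integration from `A` to `Ω`. Off the
  -- support of `φ` only the constant term of `H` survives.
  have hH0 : ∀ x, 0 ≤ H x := by
    intro x
    by_cases hx : x ∈ tsupport φ
    · have hxs := hφs hx
      refine le_trans ?_ (hmain x hxs.1 hxs.2)
      have := hψ0 x
      have := hτ0 (w x - u x)
      positivity
    · have h1 : φ x = 0 := image_eq_zero_of_notMem_tsupport hx
      have h2 := gradient_eq_zero_of_notMem_tsupport hx
      simp only [hH, hF1def, hF2def, h1, h2, inner_zero_right, mul_zero, add_zero, neg_zero,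
        zero_add]
      positivity
  have hlow : ∀ x ∈ A, ENNReal.ofReal c * ‖gradient u x‖ₑ ^ p ≤ ENNReal.ofReal (H x) := by
    rintro x ⟨⟨hx, hxδ⟩, hxO⟩
    rw [← ofReal_norm, ENNReal.ofReal_rpow_of_nonneg (norm_nonneg _) (by linarith),
      ← ENNReal.ofReal_mul hcpos.le]
    refine ENNReal.ofReal_le_ofReal (le_trans ?_ (hmain x hx (by linarith)))
    rw [hψO x hxO, hτδ _ hxδ.le, one_pow, mul_one, mul_one, hc, mul_assoc]
    have : u x ≤ M := by linarith [hwM x hx.1]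
    have : -Λ * M ≤ -Λ * u x := by nlinarith
    gcongr
  have hHI : ∫ x in Ω, H x ≤ C₀ * ∫ x in Ω, (1 + ‖gradient ψ x‖ ^ p) := by
    have h12 : IntegrableOn (fun x => F1 x + F2 x) Ω := hF1.integrableOn.add hF2.integrableOn
    have : ∫ x in Ω, H x = -((∫ x in Ω, F1 x) + ∫ x in Ω, F2 x)
        + C₀ * ∫ x in Ω, (1 + ‖gradient ψ x‖ ^ p) := by
      rw [← integral_add hF1.integrableOn hF2.integrableOn, ← integral_neg,
        ← integral_const_mul]
      exact integral_add h12.neg (hYint.const_mul C₀)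
    linarith
  have hYb : ENNReal.ofReal (∫ x in Ω, (1 + ‖gradient ψ x‖ ^ p)) ≤ 2 * volume Ω + Cψ := by
    rw [ofReal_integral_eq_lintegral_ofReal hYint
      (Eventually.of_forall fun x => by dsimp only [Pi.zero_apply]; positivity)]
    calc ∫⁻ x in Ω, ENNReal.ofReal (1 + ‖gradient ψ x‖ ^ p)
        ≤ ∫⁻ x in Ω, (2 + ‖gradient ψ x‖ₑ ^ r) := by
          refine lintegral_mono fun x => ?_
          have hY := norm_nonneg (gradient ψ x)
          have h1 := rpow_le_one_add_rpow hY (by linarith) hpr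
          dsimp only
          rw [← ofReal_norm, ENNReal.ofReal_rpow_of_nonneg hY (by linarith)]
          calc ENNReal.ofReal (1 + ‖gradient ψ x‖ ^ p)
              ≤ ENNReal.ofReal (2 + ‖gradient ψ x‖ ^ r) :=
                ENNReal.ofReal_le_ofReal (by linarith)
            _ = ENNReal.ofReal 2 + ENNReal.ofReal (‖gradient ψ x‖ ^ r) :=
                ENNReal.ofReal_add (by norm_num) (by positivity)
            _ = _ := by rw [ENNReal.ofReal_ofNat]
      _ = 2 * volume Ω + ∫⁻ x in Ω, ‖gradient ψ x‖ₑ ^ r := by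
          rw [lintegral_add_left measurable_const, setLIntegral_const]
      _ ≤ _ := by
          gcongr
          exact (setLIntegral_le_lintegral _ _).trans hψr
  have hAΩ : A ⊆ Ω := fun x hx => hDΩ hx.1.1.1
  have hfin : ENNReal.ofReal c * ∫⁻ x in A, ‖gradient u x‖ₑ ^ p
      ≤ ENNReal.ofReal C₀ * (2 * volume Ω + Cψ) := by
    calc ENNReal.ofReal c * ∫⁻ x in A, ‖gradient u x‖ₑ ^ p
        = ∫⁻ x in A, ENNReal.ofReal c * ‖gradient u x‖ₑ ^ p :=
          (lintegral_const_mul' _ _ ENNReal.ofReal_ne_top).symm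
      _ ≤ ∫⁻ x in A, ENNReal.ofReal (H x) := setLIntegral_mono' hAm hlow
      _ ≤ ∫⁻ x in Ω, ENNReal.ofReal (H x) := lintegral_mono_set hAΩ
      _ = ENNReal.ofReal (∫ x in Ω, H x) :=
          (ofReal_integral_eq_lintegral_ofReal hHint (Eventually.of_forall hH0)).symm
      _ ≤ ENNReal.ofReal (C₀ * ∫ x in Ω, (1 + ‖gradient ψ x‖ ^ p)) :=
          ENNReal.ofReal_le_ofReal hHI
      _ = ENNReal.ofReal C₀ * ENNReal.ofReal (∫ x in Ω, (1 + ‖gradient ψ x‖ ^ p)) :=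
          ENNReal.ofReal_mul hC₀0
      _ ≤ _ := by gcongr
  exact (ENNReal.mul_le_iff_le_inv (by simpa using hcpos) ENNReal.ofReal_ne_top).1 hfin

/-- The energy of a singular supersolution `u` below a regular function `w` is finite. -/
lemma lintegral_gradient_rpow_lt_top {p q r Λ M B : ℝ} {a : ℝ → ℝ} {u w : Space N → ℝ}
    {Ω D Γ : Set (Space N)} (hΩ : IsOpen Ω) (hΩb : Bornology.IsBounded Ω) (hΓ : IsCompact Γ)
    (hcap : ZeroCapacity r Γ) (hDΩ : D ⊆ Ω) (hD : IsOpen D)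
    (hp : 1 < p) (hpr : p ≤ r) (hq0 : 0 ≤ q) (hqp : q ≤ p)
    (ha : ContinuousOn a (Ici 0)) (haΛ : ∀ t ∈ Icc 0 M, |a t| ≤ Λ) (hΛ : 0 ≤ Λ) (hM : 0 ≤ M) (hB : 0 ≤ B)
    (hu : ContDiffOn ℝ 1 u (Ω \ Γ)) (huc : ContinuousOn u (closure Ω \ Γ))
    (hu0 : ∀ x ∈ Ω \ Γ, 0 ≤ u x)
    (hw : ContDiffOn ℝ 1 w D) (hwc : ContinuousOn w (closure D))
    (hwM : ∀ x ∈ D, w x ≤ M) (hwB : ∀ x ∈ D, ‖gradient w x‖ ≤ B)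
    (hbd : ∀ x ∈ closure D, x ∉ D → x ∉ Γ → w x ≤ u x)
    (hsuper : ∀ φ : Space N → ℝ, ContDiff ℝ 1 φ → HasCompactSupport φ → tsupport φ ⊆ Ω \ Γ →
      (∀ x, 0 ≤ φ x) →
      0 ≤ (∫ x in Ω, ‖gradient u x‖ ^ (p - 2) * inner ℝ (gradient u x) (gradient φ x))
        + ∫ x in Ω, a (u x) * ‖gradient u x‖ ^ q * φ x) :
    ∫⁻ x in {x ∈ D \ Γ | u x < w x}, ‖gradient u x‖ₑ ^ p < ⊤ := by
  obtain ⟨C, hC, hbound⟩ := exists_truncated_energy_bound hΩ hΩb hΓ hcap hDΩ hD hp hpr hq0 hqp ha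
    haΛ hΛ hM hB hu huc hu0 hw hwc hwM hwB hbd hsuper
  have hpos : ∀ n : ℕ, (0 : ℝ) < 1 / ((n : ℝ) + 1) := fun n => Nat.one_div_pos_of_nat
  -- One parameter `1 / (n + 1)` governs both the level of `w - u` and the distance from `Γ`. Since
  -- `Γ` is closed, these sets exhaust `{u < w}` off `Γ`.
  let A : ℕ → Set (Space N) := fun n =>
    {x ∈ D \ Γ | 1 / ((n : ℝ) + 1) < w x - u x} \ Metric.thickening (1 / ((n : ℝ) + 1)) Γ
  have hmono : Monotone A := by
    intro n m hnm x hx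
    have h := Nat.one_div_le_one_div (α := ℝ) hnm
    exact ⟨⟨hx.1.1, h.trans_lt hx.1.2⟩, fun h' => hx.2 (Metric.thickening_mono h Γ h')⟩
  have hunion : {x ∈ D \ Γ | u x < w x} ⊆ ⋃ n, A n := by
    rintro x ⟨hx, hux⟩
    have hclo : x ∉ closure Γ := by rw [hΓ.isClosed.closure_eq]; exact hx.2
    rw [Metric.closure_eq_iInter_thickening] at hclo
    simp only [mem_iInter, not_forall] at hclo
    obtain ⟨ε, hε, hxε⟩ := hclo
    obtain ⟨n, hn⟩ := exists_nat_one_div_lt (lt_min hε (sub_pos.2 hux))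
    rw [lt_min_iff] at hn
    exact mem_iUnion.2 ⟨n, ⟨hx, hn.2⟩, fun h => hxε (Metric.thickening_mono hn.1.le Γ h)⟩
  calc ∫⁻ x in {x ∈ D \ Γ | u x < w x}, ‖gradient u x‖ₑ ^ p
      ≤ ∫⁻ x in ⋃ n, A n, ‖gradient u x‖ₑ ^ p := lintegral_mono_set hunion
    _ = ⨆ n, ∫⁻ x in A n, ‖gradient u x‖ₑ ^ p :=
        setLIntegral_iUnion_of_directed _ hmono.directed_le
    _ ≤ C := iSup_le fun n => hbound _ (hpos n)
    _ < ⊤ := hC.lt_top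

end Caccioppoli

/-! ### Consequences of the structural assumptions -/

lemma ExponentAssumption.one_lt {N : ℕ} {p q : ℝ} (hN : 2 ≤ N) (h : ExponentAssumption N p q) :
    1 < p := by
  rcases h with ⟨h, -⟩ | ⟨h, -⟩
  · refine lt_trans ?_ h
    have : (2 : ℝ) ≤ N := by exact_mod_cast hN
    rw [lt_div_iff₀ (by linarith)]
    linarith
  · linarith

lemma ExponentAssumption.nonneg {N : ℕ} {p q : ℝ} (h : ExponentAssumption N p q) : 0 ≤ q := by
  rcases h with ⟨-, -, h, -⟩ | ⟨h, -, h'⟩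
  · exact zero_le_one.trans ((le_max_right _ _).trans h)
  · linarith

lemma ExponentAssumption.le {N : ℕ} {p q : ℝ} (h : ExponentAssumption N p q) : q ≤ p := by
  rcases h with ⟨-, -, -, h⟩ | ⟨-, -, h⟩
  · exact h.le
  · exact h.le

lemma CoefficientAssumption.exists_bound {a : ℝ → ℝ} (ha : CoefficientAssumption a) {M : ℝ}
    (hM : 0 < M) : ∃ Λ : ℝ, 0 ≤ Λ ∧ ∀ t ∈ Icc 0 M, |a t| ≤ Λ := by
  obtain ⟨L, hL, h⟩ := ha M hM
  refine ⟨|a 0| + L * M, by positivity, fun t ht => ?_⟩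
  have h1 := h t ht 0 ⟨le_rfl, hM.le⟩
  rw [sub_zero, abs_of_nonneg ht.1] at h1
  have h2 : L * t ≤ L * M := by gcongr; exact ht.2
  have h3 : |a t| ≤ |a t - a 0| + |a 0| := by simpa using abs_add_le (a t - a 0) (a 0)
  linarith

lemma CoefficientAssumption.continuousOn {a : ℝ → ℝ} (ha : CoefficientAssumption a) :
    ContinuousOn a (Ici 0) := by
  intro t ht
  have ht0 : (0 : ℝ) ≤ t := ht
  obtain ⟨L, hL, h⟩ := ha (t + 1) (by linarith)
  have hlip : LipschitzOnWith L.toNNReal a (Icc 0 (t + 1)) :=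
    LipschitzOnWith.of_dist_le_mul fun x hx y hy => by
      rw [Real.dist_eq, Real.dist_eq, Real.coe_toNNReal _ hL.le]
      exact h x hx y hy
  refine (hlip.continuousOn t ⟨ht0, by linarith⟩).mono_of_mem_nhdsWithin ?_
  rw [← Ici_inter_Iic]
  exact inter_mem_nhdsWithin _ (Iic_mem_nhds (by linarith))

/-! ### Geometry of the caps -/

section Geometry

variable {N : ℕ} [NeZero N]

lemma volume_hyperplane : volume {x : Space N | x 0 = 0} = 0 := by
  let L : Submodule ℝ (Space N) := LinearMap.ker (EuclideanSpace.proj (𝕜 := ℝ) (0 : Fin N)).toLinearMap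
  have hL : (L : Set (Space N)) = {x : Space N | x 0 = 0} := by
    ext x; simp [L]
  rw [← hL]
  refine Measure.addHaar_submodule _ L fun h => ?_
  have : EuclideanSpace.single (0 : Fin N) (1 : ℝ) ∈ L := h ▸ Submodule.mem_top
  simp [L] at this

lemma isOpen_leftCap {Ω : Set (Space N)} (hΩ : IsOpen Ω) (lam : ℝ) : IsOpen (leftCap Ω lam) :=
  hΩ.inter (isOpen_lt (by fun_prop : Continuous fun x : Space N => x 0) continuous_const)

lemma closure_leftCap_subset {Ω : Set (Space N)} (lam : ℝ) :
    closure (leftCap Ω lam) ⊆ {x | x 0 ≤ lam} :=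
  closure_minimal (fun _ hx => le_of_lt hx.2)
    (isClosed_le (by fun_prop : Continuous fun x : Space N => x 0) continuous_const)

/-- For `λ ≤ 0` the point `R_λ y` lies on the segment from `y` to its mirror image `R_0 y`, which is
in `Ω` by symmetry; the explicit weights are `λ / y₁` and `(y₁ - λ) / y₁`. -/
lemma reflect_mem_of_mem_leftCap {Ω : Set (Space N)} (hΩ : DomainAssumption Ω) {lam : ℝ}
    (hlam : lam ≤ 0) {y : Space N} (hy : y ∈ leftCap Ω lam) : reflect lam y ∈ Ω := by
  have hy0 : y 0 < lam := hy.2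
  refine hΩ.convex_x1 y hy.1 (reflect 0 y) (hΩ.symmetric y hy.1)
    (fun j hj => (reflect_apply_ne 0 y hj).symm) ?_
  have hneg : 0 < -y 0 := by linarith
  have h1 : (-lam) / (-y 0) + (lam - y 0) / (-y 0) = 1 := by
    rw [← add_div, div_eq_one_iff_eq hneg.ne']
    ring
  refine ⟨(-lam) / (-y 0), (lam - y 0) / (-y 0), div_nonneg (by linarith) hneg.le,
    div_nonneg (by linarith) hneg.le, h1, ?_⟩
  ext j
  by_cases hj : j = 0
  · subst hj
    simp only [PiLp.add_apply, PiLp.smul_apply, smul_eq_mul, reflect_apply_zero]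
    have : y 0 ≠ 0 := by linarith
    field_simp
    ring
  · simp only [PiLp.add_apply, PiLp.smul_apply, smul_eq_mul, reflect_apply_ne _ _ hj]
    rw [← add_mul, h1, one_mul]

end Geometry

/-! ### The positive part and the energy density -/

section PositivePart

variable {N : ℕ} [NeZero N]

lemma gradient_posDiff_of_lt {v : Space N → ℝ} {lam : ℝ} {x : Space N}
    (hv : DifferentiableAt ℝ v x) (hw : DifferentiableAt ℝ (reflected v lam) x)
    (h : reflected v lam x < v x) :
    gradient (posDiff v lam) x = gradient v x - gradient (reflected v lam) x := by
  have he : posDiff v lam =ᶠ[𝓝 x] fun y => v y - reflected v lam y := by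
    have : ∀ᶠ y in 𝓝 x, 0 < v y - reflected v lam y :=
      (hv.continuousAt.sub hw.continuousAt).eventually (lt_mem_nhds (sub_pos.2 h))
    filter_upwards [this] with y hy
    exact max_eq_left hy.le
  rw [gradient, he.fderiv_eq, fderiv_fun_sub hv hw, map_sub]
  rfl

/-- The nonnegative function `(v - v_λ)⁺` has a minimum at such a point, so its derivative, or the
default value where it is not differentiable, is zero. The contact set thus needs no separate
almost-everywhere argument. -/
lemma gradient_posDiff_of_le {v : Space N → ℝ} {lam : ℝ} {x : Space N}
    (h : v x ≤ reflected v lam x) : gradient (posDiff v lam) x = 0 := by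
  have hmin : IsLocalMin (posDiff v lam) x := Eventually.of_forall fun y => by
    have : posDiff v lam x = 0 := max_eq_right (by linarith)
    rw [this]
    exact le_max_right _ _
  rw [gradient, hmin.fderiv_eq_zero, map_zero]

end PositivePart

lemma isOpen_sep_lt {E : Type*} [TopologicalSpace E] {s : Set E} {f g : E → ℝ} (hs : IsOpen s)
    (hf : ContinuousOn f s) (hg : ContinuousOn g s) : IsOpen {x ∈ s | f x < g x} := by
  have : {x ∈ s | f x < g x} = s ∩ (fun x => g x - f x) ⁻¹' Set.Ioi 0 := by
    ext x; simp
  rw [this]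
  exact (hg.sub hf).isOpen_inter_preimage hs isOpen_Ioi

/-- The energy density is integrable over the cap as soon as the energy of the reflected function
below the function itself is finite. -/
lemma integrableOn_energyDensity {N : ℕ} [NeZero N] {p B lam : ℝ} {v : Space N → ℝ}
    {O Z : Set (Space N)} (hp : 1 < p) (hO : IsOpen O) (hOb : Bornology.IsBounded O)
    (hZ : IsClosed Z) (hZ0 : volume Z = 0)
    (hv : ContDiffOn ℝ 1 v O) (hw : ContDiffOn ℝ 1 (reflected v lam) (O \ Z))
    (hB : ∀ x ∈ O, ‖gradient v x‖ ≤ B)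
    (hfin : ∫⁻ x in {x ∈ O \ Z | reflected v lam x < v x},
      ‖gradient (reflected v lam) x‖ₑ ^ p < ⊤) :
    IntegrableOn (energyDensity p v lam) O := by
  set w := reflected v lam with hwdef
  set P := {x ∈ O \ Z | w x < v x} with hP
  have hOZ : IsOpen (O \ Z) := hO.sdiff hZ
  have hPo : IsOpen P :=
    isOpen_sep_lt hOZ hw.continuousOn (hv.continuousOn.mono sdiff_subset)
  have hPm := hPo.measurableSet
  have hPO : P ⊆ O := fun x hx => hx.1.1
  have hPb : volume P < ⊤ := (hOb.subset hPO).measure_lt_top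
  set F := fun x => (‖gradient v x‖ + ‖gradient w x‖) ^ (p - 2)
    * ‖gradient v x - gradient w x‖ ^ 2 with hF
  have heq : ∀ x ∈ O \ Z, energyDensity p v lam x = P.indicator F x := by
    intro x hx
    by_cases hlt : w x < v x
    · rw [indicator_of_mem (show x ∈ P from ⟨hx, hlt⟩), energyDensity,
        gradient_posDiff_of_lt
          ((hv.contDiffAt (hO.mem_nhds hx.1)).differentiableAt one_ne_zero)
          ((hw.contDiffAt (hOZ.mem_nhds hx)).differentiableAt one_ne_zero) hlt]
    · rw [indicator_of_notMem (fun h => hlt h.2), energyDensity,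
        gradient_posDiff_of_le (not_lt.1 hlt)]
      simp
  have hgv : AEStronglyMeasurable (gradient v) (volume.restrict P) :=
    ((continuousOn_gradient hO hv).mono hPO).aestronglyMeasurable hPm
  have hgw : AEStronglyMeasurable (gradient w) (volume.restrict P) :=
    ((continuousOn_gradient hOZ hw).mono fun x hx => hx.1).aestronglyMeasurable hPm
  have hFP : IntegrableOn F P := by
    refine ⟨((hgv.norm.add hgw.norm).aemeasurable.pow_const _).aestronglyMeasurable.mul
      ((hgv.sub hgw).norm.pow 2), ?_⟩
    have hbound : ∀ x ∈ P, ‖F x‖ₑ ≤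
        ENNReal.ofReal (2 ^ p) * (ENNReal.ofReal (B ^ p) + ‖gradient w x‖ₑ ^ p) := by
      intro x hx
      have hv0 := norm_nonneg (gradient v x)
      have hw0 := norm_nonneg (gradient w x)
      have hBx := hB x (hPO hx)
      have hB0 : 0 ≤ B := hv0.trans hBx
      rw [Real.enorm_of_nonneg (by simp only [hF]; positivity), ← ofReal_norm,
        ENNReal.ofReal_rpow_of_nonneg hw0 (by linarith),
        ← ENNReal.ofReal_add (by positivity) (by positivity),
        ← ENNReal.ofReal_mul (by positivity)]
      refine ENNReal.ofReal_le_ofReal ?_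
      -- Since `|∇v - ∇w| ≤ |∇v| + |∇w|`, the weight of exponent `p - 2` is harmless.
      calc F x ≤ (‖gradient v x‖ + ‖gradient w x‖) ^ p :=
            rpow_sub_two_mul_sq_le (by positivity) (norm_nonneg _) (norm_sub_le _ _) hp
        _ ≤ (B + ‖gradient w x‖) ^ p := by gcongr
        _ ≤ _ := add_rpow_le hB0 hw0 (by linarith)
    calc ∫⁻ x in P, ‖F x‖ₑ
        ≤ ∫⁻ x in P, ENNReal.ofReal (2 ^ p) * (ENNReal.ofReal (B ^ p) + ‖gradient w x‖ₑ ^ p) :=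
          setLIntegral_mono' hPm hbound
      _ = ENNReal.ofReal (2 ^ p) * (ENNReal.ofReal (B ^ p) * volume P
            + ∫⁻ x in P, ‖gradient w x‖ₑ ^ p) := by
          rw [lintegral_const_mul' _ _ ENNReal.ofReal_ne_top, lintegral_add_left measurable_const,
            setLIntegral_const]
      _ < ⊤ := by finiteness
  have hind : IntegrableOn (P.indicator F) O :=
    ((integrable_indicator_iff hPm).2 hFP).integrableOn
  refine hind.congr ?_
  have hae : ∀ᵐ x ∂(volume.restrict O), x ∉ Z :=
    ae_restrict_of_ae (measure_eq_zero_iff_ae_notMem.1 hZ0)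
  filter_upwards [hae, ae_restrict_mem hO.measurableSet] with x hxZ hxO
  exact (heq x ⟨hxO, hxZ⟩).symm

lemma IsWeakSolution.integral_nonneg {N m : ℕ} {α : ℝ≥0} {Ω Γ : Set (Space N)}
    {p q : Fin m → ℝ} {a : Fin m → ℝ → ℝ} {f : Fin m → (Fin m → ℝ) → ℝ}
    {u : Fin m → Space N → ℝ} (hu : IsWeakSolution α Ω Γ p q a f u) (hf : SourceAssumption f)
    (hΩ : IsOpen Ω) (i : Fin m) {φ : Space N → ℝ} (hφ : ContDiff ℝ 1 φ)
    (hφc : HasCompactSupport φ) (hφs : tsupport φ ⊆ Ω \ Γ) (hφ0 : ∀ x, 0 ≤ φ x) :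
    0 ≤ (∫ x in Ω, ‖gradient (u i) x‖ ^ (p i - 2)
        * inner ℝ (gradient (u i) x) (gradient φ x))
      + ∫ x in Ω, a i (u i x) * ‖gradient (u i) x‖ ^ (q i) * φ x := by
  rw [hu.equation i φ hφ hφc hφs]
  refine setIntegral_nonneg hΩ.measurableSet fun x hx => ?_
  by_cases hxΓ : x ∈ Γ
  · rw [image_eq_zero_of_notMem_tsupport fun h => (hφs h).2 hxΓ, mul_zero]
  · exact mul_nonneg (hf.pos i _ fun k => hu.pos k x ⟨hx, hxΓ⟩).le (hφ0 x)

end SingularPLaplace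

end

/-! ### The theorem -/

open SingularPLaplace in
theorem lemma2p3 {N m : ℕ} [NeZero N] (hN : 2 ≤ N)
    (Ω Γ : Set (SingularPLaplace.Space N)) (p q : Fin m → ℝ)
    (a : Fin m → ℝ → ℝ) (f : Fin m → (Fin m → ℝ) → ℝ)
    (hΩ : SingularPLaplace.DomainAssumption Ω)
    (hΓ : SingularPLaplace.SingularSetAssumption Ω Γ (⨆ k, p k))
    (hpq : ∀ i, SingularPLaplace.ExponentAssumption N (p i) (q i))
    (ha : ∀ i, SingularPLaplace.CoefficientAssumption (a i))
    (hf : SingularPLaplace.SourceAssumption f)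
    (α : ℝ≥0) (hα0 : 0 < α) (hα1 : α ≤ 1)
    (u : Fin m → SingularPLaplace.Space N → ℝ)
    (hu : SingularPLaplace.IsWeakSolution α Ω Γ p q a f u)
    (i : Fin m) (lam : ℝ) (hlam : lam ∈ Set.Ioo (SingularPLaplace.leftEnd Ω) 0)
    (hmeet : (SingularPLaplace.reflect lam '' Γ ∩
      closure (SingularPLaplace.leftCap Ω lam)).Nonempty) :
    ∃ c : ℝ, 0 < c ∧
      IntegrableOn (SingularPLaplace.energyDensity (p i) (u i) lam)
        (SingularPLaplace.leftCap Ω lam) ∧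
      ∫ x in SingularPLaplace.leftCap Ω lam,
        SingularPLaplace.energyDensity (p i) (u i) lam x ≤ c := by
  -- Given integrability, the integral is a real number; adding `1` to its absolute value makes the
  -- constant positive.
  suffices hint : IntegrableOn (energyDensity (p i) (u i) lam) (leftCap Ω lam) from
    ⟨|∫ x in leftCap Ω lam, energyDensity (p i) (u i) lam x| + 1, by positivity, hint,
      (le_abs_self _).trans (by linarith)⟩
  obtain ⟨huc, G, hGc, hG, -⟩ := hu.regular i
  set v := u i with hv
  set w := reflected v lam with hw
  have hp := (hpq i).one_lt hN
  have hΓc : IsClosed Γ := hΓ.isCompact.isClosed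
  have hΩΓ : IsOpen (Ω \ Γ) := hΩ.isOpen.sdiff hΓc
  have hvC : ContDiffOn ℝ 1 v (Ω \ Γ) :=
    contDiffOn_of_hasGradientAt hΩΓ
      (hGc.mono (Set.sdiff_subset_sdiff_left subset_closure)) hG
  have hcapo := isOpen_leftCap hΩ.isOpen lam
  have hcapb : Bornology.IsBounded (leftCap Ω lam) := hΩ.isBounded.subset fun x hx => hx.1
  have hcapK : IsCompact (closure (leftCap Ω lam)) := hcapb.isCompact_closure
  have hcapcl : closure (leftCap Ω lam) ⊆ closure Ω \ Γ := fun x hx =>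
    ⟨closure_mono (fun y hy => hy.1) hx, fun hxΓ => by
      have h1 : x 0 ≤ lam := closure_leftCap_subset lam hx
      have h2 : x 0 = 0 := (hΓ.subset hxΓ).2
      linarith [hlam.2]⟩
  have hcapΩ : leftCap Ω lam ⊆ Ω \ Γ := fun x hx => ⟨hx.1, (hcapcl (subset_closure hx)).2⟩
  obtain ⟨M, hM⟩ := hcapK.exists_bound_of_continuousOn (huc.mono hcapcl)
  -- The continuous extension `G` bounds the gradient up to the part of `∂Ω` that touches the cap.
  obtain ⟨B, hB⟩ := hcapK.exists_bound_of_continuousOn (hGc.mono hcapcl)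
  obtain ⟨Λ, hΛ, haΛ⟩ := (ha i).exists_bound (M := max M 1) (by positivity)
  have hDo : IsOpen (reflect lam ⁻¹' leftCap Ω lam) := hcapo.preimage (continuous_reflect lam)
  have hDcl : closure (reflect lam ⁻¹' leftCap Ω lam)
      ⊆ reflect lam ⁻¹' closure (leftCap Ω lam) :=
    (continuous_reflect lam).closure_preimage_subset _
  have hDΩ : reflect lam ⁻¹' leftCap Ω lam ⊆ Ω := fun x hx => by
    simpa [reflect_reflect] using reflect_mem_of_mem_leftCap hΩ hlam.2.le hx
  have hgrad : ∀ x ∈ Ω \ Γ, gradient v x = G x := fun x hx => (hG x hx).gradient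
  have hgradw : ∀ x, reflect lam x ∈ Ω \ Γ →
      ‖gradient w x‖ = ‖gradient v (reflect lam x)‖ := fun x hx => by
    rw [hgrad _ hx, (hasGradientAt_reflected (hG _ hx)).gradient, LinearIsometryEquiv.norm_map]
  -- A boundary point of the reflected cap either lies on `x₁ = λ`, where `w = v`, or is the
  -- reflection of a point of `∂Ω`, where `w = 0 ≤ v`.
  have hbd : ∀ x ∈ closure (reflect lam ⁻¹' leftCap Ω lam),
      x ∉ reflect lam ⁻¹' leftCap Ω lam → x ∉ Γ → w x ≤ v x := by
    intro x hx hxD hxΓ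
    have hy := hDcl hx
    have hy0 : reflect lam x 0 ≤ lam := closure_leftCap_subset lam hy
    by_cases hyΩ : reflect lam x ∈ Ω
    · have hylam : reflect lam x 0 = lam := by
        by_contra h
        exact hxD ⟨hyΩ, lt_of_le_of_ne hy0 h⟩
      have hfix := reflect_eq_self hylam
      rw [reflect_reflect] at hfix
      show v (reflect lam x) ≤ v x
      rw [← hfix]
    · have hfr : reflect lam x ∈ frontier Ω := by
        rw [hΩ.isOpen.frontier_eq]
        exact ⟨(hcapcl hy).1, hyΩ⟩
      have hw0 : w x = 0 := hu.boundary i _ hfr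
      rw [hw0]
      by_cases hxΩ : x ∈ Ω
      · exact (hu.pos i x ⟨hxΩ, hxΓ⟩).le
      · refine (hu.boundary i x ?_).ge
        rw [hΩ.isOpen.frontier_eq]
        exact ⟨closure_mono hDΩ hx, hxΩ⟩
  have henergy := lintegral_gradient_rpow_lt_top (w := w) (B := max B 0) hΩ.isOpen hΩ.isBounded
    hΓ.isCompact hΓ.zeroCapacity hDΩ hDo hp (le_ciSup (Set.finite_range p).bddAbove i)
    (hpq i).nonneg (hpq i).le (ha i).continuousOn haΛ hΛ (by positivity) (by positivity) hvC huc
    (fun x hx => (hu.pos i x hx).le)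
    (hvC.comp (contDiff_reflect lam).contDiffOn fun x hx => hcapΩ hx)
    (huc.comp (continuous_reflect lam).continuousOn fun x hx => hcapcl (hDcl hx))
    (fun x hx => (le_abs_self _).trans ((hM _ (subset_closure hx)).trans (le_max_left _ _)))
    (fun x hx => by
      rw [hgradw x (hcapΩ hx), hgrad _ (hcapΩ hx)]
      exact (hB _ (subset_closure hx)).trans (le_max_left _ _))
    hbd (fun φ h1 h2 h3 h4 => hu.integral_nonneg hf hΩ.isOpen i h1 h2 h3 h4)
  have hmaps : ∀ x ∈ leftCap Ω lam \ reflect lam ⁻¹' Γ, reflect lam x ∈ Ω \ Γ := fun x hx =>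
    ⟨reflect_mem_of_mem_leftCap hΩ hlam.2.le hx.1, hx.2⟩
  -- As `R_λ` is an involution, it interchanges `v` and `w` and carries the energy bound back to the
  -- cap.
  have hset : reflect lam ⁻¹' {x ∈ (reflect lam ⁻¹' leftCap Ω lam) \ Γ | v x < w x}
      = {x ∈ leftCap Ω lam \ reflect lam ⁻¹' Γ | w x < v x} := by
    ext x
    simp [hw, reflected, reflect_reflect]
  have hwC : ContDiffOn ℝ 1 w (leftCap Ω lam \ reflect lam ⁻¹' Γ) :=
    hvC.comp (contDiff_reflect lam).contDiffOn hmaps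
  have hPm : MeasurableSet {x ∈ leftCap Ω lam \ reflect lam ⁻¹' Γ | w x < v x} :=
    (isOpen_sep_lt (hcapo.sdiff (hΓc.preimage (continuous_reflect lam))) hwC.continuousOn
      ((hvC.mono hcapΩ).continuousOn.mono Set.sdiff_subset)).measurableSet
  refine integrableOn_energyDensity (B := B) hp hcapo hcapb (hΓc.preimage (continuous_reflect lam))
    ?_ (hvC.mono hcapΩ) hwC
    (fun x hx => by rw [hgrad x (hcapΩ hx)]; exact hB x (subset_closure hx)) ?_
  · exact (measurePreserving_reflect lam).quasiMeasurePreserving.preimage_null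
      (measure_mono_null (fun x hx => (hΓ.subset hx).2) volume_hyperplane)
  · rw [← (measurePreserving_reflect lam).setLIntegral_comp_preimage_emb
      (measurableEmbedding_reflect lam), hset] at henergy
    refine lt_of_eq_of_lt (setLIntegral_congr_fun hPm fun x hx => ?_) henergy
    show ‖gradient w x‖ₑ ^ p i = ‖gradient v (reflect lam x)‖ₑ ^ p i
    rw [← ofReal_norm, hgradw x (hmaps x hx.1), ofReal_norm]
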